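/- Let $\Omega\subset\mathbb{C}^d$ be an arbitrary bounded domain (a nonempty bounded connected open set), and let $H^2(\Omega)$ be its Bergman space, i.e. the closed subspace of $L^2(\Omega)$ (with respect to Lebesgue measure) consisting of holomorphic functions, with Bergman kernel $B(z,w)$, the integral kernel of the orthogonal projection of $L^2(\Omega)$ onto $H^2(\Omega)$. Let $\mu$ be a complex regular Borel measure with compact support in $\Omega$. Let $A(\mu)=(a_{\alpha\beta})_{\alpha,\beta\in\mathbb{Z}_+^d}$ be the infinite matrix of moments $a_{\alpha\beta}=\int z^\alpha\bar z^\beta\,d\mu(z)$, and let $T_\mu^\Omega:H^2(\Omega)\to H^2(\Omega)$ be the Toeplitz–Bergman operator $$(T_\mu^\Omega u)(z)=\int B(z,w)\,u(w)\,d\mu(w),\qquad u\in H^2(\Omega).$$ Then $$\operatorname{rank}A(\mu)=\operatorname{rank}T_\mu^\Omega$$ as elements of $\{0,1,2,\dots,\infty\}$; in particular one of the ranks is finite if and only if the other is. -/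

import Mathlib

namespace BergmanToeplitz

open MeasureTheory Set Filter Topology TopologicalSpace Metric
open scoped ENNReal ComplexConjugate

noncomputable section

/-! ### Integration against a complex measure -/

/-- The integral `∫ f dμ` of a complex function against a complex measure. -/
def cintegral {X : Type*} [MeasurableSpace X] (μ : ComplexMeasure X) (f : X → ℂ) : ℂ :=
  VectorMeasure.integral μ f (ContinuousLinearMap.mul ℝ ℂ)

/-- A complex measure has finite total variation. -/
theorem isFiniteMeasure_variation {X : Type*} [MeasurableSpace X] (μ : ComplexMeasure X) :
    IsFiniteMeasure (VectorMeasure.variation μ) := by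
  have h : VectorMeasure.variation μ ≤
      (ComplexMeasure.re μ).totalVariation + (ComplexMeasure.im μ).totalVariation := by
    apply VectorMeasure.variation_le_of_forall_enorm_le
    intro E hE
    have h1 := SignedMeasure.enorm_le_totalVariation (ComplexMeasure.re μ) E
    have h2 := SignedMeasure.enorm_le_totalVariation (ComplexMeasure.im μ) E
    have e : μ E = ((ComplexMeasure.re μ E : ℝ) : ℂ) + ((ComplexMeasure.im μ E : ℝ) : ℂ) * Complex.I :=
      (Complex.re_add_im (μ E)).symm
    rw [e, Measure.add_apply]
    refine (enorm_add_le _ _).trans (add_le_add (le_trans (le_of_eq ?_) h1)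
      (le_trans (le_of_eq ?_) h2))
    · rw [← ofReal_norm, ← ofReal_norm, Complex.norm_real]
    · rw [← ofReal_norm, ← ofReal_norm, norm_mul, Complex.norm_I, mul_one, Complex.norm_real]
  have : IsFiniteMeasure ((ComplexMeasure.re μ).totalVariation +
      (ComplexMeasure.im μ).totalVariation) := by
    unfold SignedMeasure.totalVariation
    infer_instance
  exact isFiniteMeasure_of_le _ h

theorem cintegral_add {X : Type*} [MeasurableSpace X] (μ : ComplexMeasure X) {f g : X → ℂ}
    (hf : Integrable f (VectorMeasure.variation μ)) (hg : Integrable g (VectorMeasure.variation μ)) :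
    cintegral μ (fun x => f x + g x) = cintegral μ f + cintegral μ g :=
  VectorMeasure.integral_fun_add hf hg

theorem cintegral_const_mul {X : Type*} [MeasurableSpace X] (μ : ComplexMeasure X) (c : ℂ)
    (f : X → ℂ) : cintegral μ (fun x => c * f x) = c * cintegral μ f := by
  have := setToFun_smul (𝕜 := ℂ)
    (dominatedFinMeasAdditive_cbmApplyMeasure μ (ContinuousLinearMap.mul ℝ ℂ)) (by
      intro c s x
      change (c * x) * μ s = c * (x * μ s)
      ring) c f
  exact this

theorem norm_cintegral_le {X : Type*} [MeasurableSpace X] (μ : ComplexMeasure X)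
    {f : X → ℂ} {C : ℝ} (h : ∀ᵐ x ∂(VectorMeasure.variation μ), ‖f x‖ ≤ C) :
    ‖cintegral μ f‖ ≤ C * (‖ContinuousLinearMap.mul ℝ ℂ‖ *
      (VectorMeasure.variation μ).real univ) := by
  have := isFiniteMeasure_variation μ
  rw [← mul_assoc]
  exact VectorMeasure.norm_integral_le_of_norm_le_const h

/-- The complex measure `μ` on `ℂ^d` lives on a compact subset of `Ω`. -/
def HasCompactSupportIn {d : ℕ} (μ : ComplexMeasure (Fin d → ℂ)) (Ω : Opens (Fin d → ℂ)) : Prop :=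
  ∃ K : Set (Fin d → ℂ), IsCompact K ∧ K ⊆ Ω ∧
    ∀ s, MeasurableSet s → Disjoint s K → μ s = 0

/-- The moment matrix `a_{αβ} = ∫ z^α conj(z)^β dμ(z)`, indexed by multi-indices. -/
def momentMatrix {d : ℕ} (μ : ComplexMeasure (Fin d → ℂ)) :
    Matrix (Fin d → ℕ) (Fin d → ℕ) ℂ :=
  Matrix.of fun α β => cintegral μ fun z => (∏ j, z j ^ α j) * ∏ j, conj (z j) ^ β j

/-! ### The Bergman space -/

/-- The Bergman space `H²(Ω)`: the subspace of `L²(Ω)` (with respect to Lebesgue measure on `ℂ^d`)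
of the classes that contain a function holomorphic in `Ω`. -/
def bergmanSpace {d : ℕ} (Ω : Opens (Fin d → ℂ)) :
    Submodule ℂ (Lp ℂ 2 (volume.restrict (Ω : Set (Fin d → ℂ)))) where
  carrier := {f | ∃ u : (Fin d → ℂ) → ℂ, DifferentiableOn ℂ u Ω ∧
    f =ᵐ[volume.restrict (Ω : Set (Fin d → ℂ))] u}
  add_mem' := by
    rintro f g ⟨u, hu, hfu⟩ ⟨v, hv, hgv⟩
    exact ⟨u + v, hu.add hv, (Lp.coeFn_add f g).trans (hfu.add hgv)⟩
  zero_mem' := ⟨0, differentiableOn_const 0, Lp.coeFn_zero ..⟩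
  smul_mem' := by
    rintro c f ⟨u, hu, hfu⟩
    exact ⟨c • u, hu.const_smul c, (Lp.coeFn_smul c f).trans (hfu.const_smul c)⟩

variable {d : ℕ} {Ω : Opens (Fin d → ℂ)}

/-- The holomorphic representative of an element of the Bergman space, extended by `0` outside
`Ω`. -/
def holo (f : bergmanSpace Ω) : (Fin d → ℂ) → ℂ :=
  (Ω : Set (Fin d → ℂ)).indicator f.2.choose

theorem holo_differentiableOn (f : bergmanSpace Ω) : DifferentiableOn ℂ (holo f) Ω :=
  f.2.choose_spec.1.congr fun _ hz => indicator_of_mem hz _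

theorem coe_ae_eq_holo (f : bergmanSpace Ω) :
    (f : Lp ℂ 2 (volume.restrict (Ω : Set (Fin d → ℂ))))
      =ᵐ[volume.restrict (Ω : Set (Fin d → ℂ))] holo f := by
  filter_upwards [f.2.choose_spec.2, ae_restrict_mem Ω.isOpen.measurableSet] with z hz hzΩ
  rw [hz, holo, indicator_of_mem hzΩ]

theorem holo_of_notMem (f : bergmanSpace Ω) {z : Fin d → ℂ} (hz : z ∉ Ω) : holo f z = 0 :=
  indicator_of_notMem hz _

/-- The holomorphic representative is unique on `Ω`. -/
theorem holo_eqOn_of_ae_eq (f : bergmanSpace Ω) {u : (Fin d → ℂ) → ℂ}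
    (hu : DifferentiableOn ℂ u Ω)
    (h : (f : Lp ℂ 2 (volume.restrict (Ω : Set (Fin d → ℂ))))
      =ᵐ[volume.restrict (Ω : Set (Fin d → ℂ))] u) :
    EqOn (holo f) u Ω :=
  Measure.eqOn_open_of_ae_eq ((coe_ae_eq_holo f).symm.trans h) Ω.isOpen
    (holo_differentiableOn f).continuousOn hu.continuousOn

theorem holo_add (f g : bergmanSpace Ω) : holo (f + g) = holo f + holo g := by
  funext z
  by_cases hz : z ∈ Ω
  · refine holo_eqOn_of_ae_eq (f + g) ((holo_differentiableOn f).add (holo_differentiableOn g))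
      ?_ hz
    exact (Lp.coeFn_add _ _).trans ((coe_ae_eq_holo f).add (coe_ae_eq_holo g))
  · simp [holo_of_notMem _ hz]

theorem holo_smul (c : ℂ) (f : bergmanSpace Ω) : holo (c • f) = c • holo f := by
  funext z
  by_cases hz : z ∈ Ω
  · refine holo_eqOn_of_ae_eq (c • f) ((holo_differentiableOn f).const_smul c) ?_ hz
    exact (Lp.coeFn_smul _ _).trans ((coe_ae_eq_holo f).const_smul c)
  · simp [holo_of_notMem _ hz]

theorem holo_sub (f g : bergmanSpace Ω) : holo (f - g) = holo f - holo g := by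
  rw [sub_eq_add_neg, ← neg_one_smul ℂ g, holo_add, holo_smul, neg_one_smul, ← sub_eq_add_neg]

theorem measurable_holo (f : bergmanSpace Ω) : Measurable (holo f) := by
  classical
  have h := (holo_differentiableOn f).continuousOn.measurable_piecewise
    (g := fun _ => (0 : ℂ)) continuous_const.continuousOn Ω.isOpen.measurableSet
  convert h using 1
  funext z
  by_cases hz : z ∈ (Ω : Set (Fin d → ℂ))
  · simp [hz]
  · simp [hz, holo_of_notMem f hz]

/-! ### Point evaluations are bounded -/

/-- Multiplication by a number of modulus one preserves Lebesgue measure on `ℂ^d`. -/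
theorem measurePreserving_circle_smul (c : Circle) :
    MeasurePreserving (fun w : Fin d → ℂ => (c : ℂ) • w) := by
  have h := volume_preserving_pi (ι := Fin d) (f := fun _ => fun z : ℂ => rotation c z)
    (fun _ => (rotation c).measurePreserving)
  exact h

/-- The sub-mean value inequality over a ball, for holomorphic functions. -/
theorem enorm_mul_volume_le {u : (Fin d → ℂ) → ℂ} (hu : DifferentiableOn ℂ u Ω)
    (hum : Measurable u) {z : Fin d → ℂ} {r : ℝ} (hz : ball z r ⊆ Ω) :
    ‖u z‖ₑ * volume (ball z r) ≤ ∫⁻ w in ball z r, ‖u w‖ₑ := by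
  set c₀ : ℝ≥0∞ := ENNReal.ofReal (2 * Real.pi)⁻¹ with hc₀
  have key : ∀ w ∈ ball (0 : Fin d → ℂ) r, ‖u z‖ₑ ≤
      c₀ * ∫⁻ θ in Ioc 0 (2 * Real.pi), ‖u (z + circleMap 0 1 θ • w)‖ₑ := by
    intro w hw
    have hmaps : MapsTo (fun c : ℂ => z + c • w) (closedBall 0 1) Ω := by
      intro c hc
      apply hz
      rw [mem_ball_iff_norm, add_sub_cancel_left, norm_smul]
      have h1 : ‖c‖ ≤ 1 := by simpa using hc
      have h2 : ‖w‖ < r := by simpa using hw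
      nlinarith [norm_nonneg w, norm_nonneg c]
    have hd : DifferentiableOn ℂ (fun c : ℂ => u (z + c • w)) (closedBall 0 1) :=
      hu.comp (by fun_prop) hmaps
    have hdc : DiffContOnCl ℂ (fun c : ℂ => u (z + c • w)) (ball 0 |1|) := by
      apply DifferentiableOn.diffContOnCl
      rw [abs_one, closure_ball _ one_ne_zero]
      exact hd
    have hav := hdc.circleAverage
    simp only [zero_smul, add_zero] at hav
    rw [← hav, Real.circleAverage, enorm_smul,
      intervalIntegral.integral_of_le Real.two_pi_pos.le]
    refine mul_le_mul' (le_of_eq ?_) (enorm_integral_le_lintegral_enorm _)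
    rw [hc₀, Real.enorm_of_nonneg (by positivity)]
  have hshift : ∀ F : (Fin d → ℂ) → ℝ≥0∞, Measurable F →
      ∫⁻ w in ball z r, F w = ∫⁻ w in ball 0 r, F (z + w) := by
    intro F hF
    have hp : (fun w => z + w) ⁻¹' ball z r = ball 0 r := by
      ext w; simp
    rw [← hp, (measurePreserving_add_left volume z).setLIntegral_comp_preimage
      measurableSet_ball hF]
  have hrot : ∀ θ : ℝ, ∫⁻ w in ball (0 : Fin d → ℂ) r, ‖u (z + circleMap 0 1 θ • w)‖ₑ =
      ∫⁻ w in ball (0 : Fin d → ℂ) r, ‖u (z + w)‖ₑ := by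
    intro θ
    have hp : (fun w : Fin d → ℂ => ((Circle.exp θ : Circle) : ℂ) • w) ⁻¹' ball 0 r =
        ball 0 r := by
      ext w
      simp [norm_smul]
    have hm : Measurable fun w => ‖u (z + w)‖ₑ := by fun_prop
    have := (measurePreserving_circle_smul (d := d) (Circle.exp θ)).setLIntegral_comp_preimage
      (s := ball 0 r) measurableSet_ball hm
    rw [hp] at this
    rw [← this]
    simp [circleMap, Circle.coe_exp]
  rw [hshift _ hum.enorm]
  calc ‖u z‖ₑ * volume (ball z r) = ∫⁻ _ in ball (0 : Fin d → ℂ) r, ‖u z‖ₑ := by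
        rw [setLIntegral_const, Measure.addHaar_ball_center]
    _ ≤ ∫⁻ w in ball (0 : Fin d → ℂ) r,
        c₀ * ∫⁻ θ in Ioc 0 (2 * Real.pi), ‖u (z + circleMap 0 1 θ • w)‖ₑ :=
        setLIntegral_mono' measurableSet_ball key
    _ = c₀ * ∫⁻ w in ball (0 : Fin d → ℂ) r,
        ∫⁻ θ in Ioc 0 (2 * Real.pi), ‖u (z + circleMap 0 1 θ • w)‖ₑ :=
        lintegral_const_mul' _ _ ENNReal.ofReal_ne_top
    _ = c₀ * ∫⁻ θ in Ioc 0 (2 * Real.pi), ∫⁻ w in ball (0 : Fin d → ℂ) r,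
        ‖u (z + circleMap 0 1 θ • w)‖ₑ := by
        rw [lintegral_lintegral_swap]
        apply Measurable.aemeasurable
        have hmeas : Measurable fun p : (Fin d → ℂ) × ℝ => z + circleMap 0 1 p.2 • p.1 := by
          apply Continuous.measurable
          have := continuous_circleMap 0 1
          fun_prop
        exact (hum.comp hmeas).enorm
    _ = c₀ * (ENNReal.ofReal (2 * Real.pi) * ∫⁻ w in ball (0 : Fin d → ℂ) r, ‖u (z + w)‖ₑ) := by
        simp_rw [hrot]
        rw [setLIntegral_const, Real.volume_Ioc, sub_zero, mul_comm (lintegral _ _)]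
    _ = ∫⁻ w in ball (0 : Fin d → ℂ) r, ‖u (z + w)‖ₑ := by
        rw [← mul_assoc, hc₀, ← ENNReal.ofReal_mul (by positivity),
          inv_mul_cancel₀ (by positivity), ENNReal.ofReal_one, one_mul]

theorem exists_norm_holo_le {K : Set (Fin d → ℂ)} (hK : IsCompact K) (hKΩ : K ⊆ Ω) :
    ∃ C : ℝ, 0 ≤ C ∧ ∀ f : bergmanSpace Ω, ∀ z ∈ K, ‖holo f z‖ ≤ C * ‖f‖ := by
  obtain ⟨δ, hδ, hδΩ⟩ := hK.exists_cthickening_subset_open Ω.isOpen hKΩ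
  set V : ℝ≥0∞ := volume (ball (0 : Fin d → ℂ) δ) with hV
  have hV0 : V ≠ 0 := (measure_ball_pos _ _ hδ).ne'
  have hVt : V ≠ ∞ := measure_ball_lt_top.ne
  have hVh : V ^ ((1 : ℝ) / 2) / V ≠ ∞ :=
    ENNReal.div_ne_top (ENNReal.rpow_ne_top_of_nonneg (by norm_num) hVt) hV0
  refine ⟨(V ^ ((1 : ℝ) / 2) / V).toReal, ENNReal.toReal_nonneg, fun f z hz => ?_⟩
  have hb : ball z δ ⊆ Ω := fun w hw => hδΩ
    (mem_cthickening_of_dist_le w z δ K hz (mem_ball.1 hw).le)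
  have h1 := enorm_mul_volume_le (holo_differentiableOn f) (measurable_holo f) hb
  rw [Measure.addHaar_ball_center, ← hV, ← eLpNorm_one_eq_lintegral_enorm] at h1
  have h2 := eLpNorm_le_eLpNorm_mul_rpow_measure_univ (p := 1) (q := 2)
    (μ := volume.restrict (ball z δ)) (by norm_num) (measurable_holo f).aestronglyMeasurable
  have h3 : eLpNorm (holo f) 2 (volume.restrict (ball z δ)) ≤ ‖f‖ₑ := by
    refine (eLpNorm_mono_measure _ (Measure.restrict_mono hb le_rfl)).trans (le_of_eq ?_)
    rw [← eLpNorm_congr_ae (coe_ae_eq_holo f), ← Lp.enorm_def]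
    rfl
  rw [Measure.restrict_apply_univ, Measure.addHaar_ball_center, ← hV] at h2
  norm_num at h2
  have h4 : ‖holo f z‖ₑ * V ≤ ‖f‖ₑ * V ^ ((1 : ℝ) / 2) :=
    h1.trans (h2.trans (by gcongr))
  have h5 : ‖holo f z‖ₑ ≤ V ^ ((1 : ℝ) / 2) / V * ‖f‖ₑ := by
    rw [mul_comm, ← mul_div_assoc]
    exact (ENNReal.le_div_iff_mul_le (Or.inl hV0) (Or.inl hVt)).2 h4
  have h6 := ENNReal.toReal_mono (ENNReal.mul_ne_top hVh enorm_ne_top) h5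
  rwa [ENNReal.toReal_mul, toReal_enorm, toReal_enorm] at h6

theorem exists_norm_fderiv_holo_le {K : Set (Fin d → ℂ)} (hK : IsCompact K) (hKΩ : K ⊆ Ω) :
    ∃ C : ℝ, 0 ≤ C ∧ ∀ f : bergmanSpace Ω, ∀ z ∈ K, ‖fderiv ℂ (holo f) z‖ ≤ C * ‖f‖ := by
  obtain ⟨δ, hδ, hδΩ⟩ := hK.exists_cthickening_subset_open Ω.isOpen hKΩ
  obtain ⟨C, hC0, hC⟩ := exists_norm_holo_le (hK.cthickening (r := δ)) hδΩ
  refine ⟨2 * C / δ, by positivity, fun f z hz => ?_⟩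
  have hb : ball z δ ⊆ cthickening δ K := fun w hw =>
    mem_cthickening_of_dist_le w z δ K hz (mem_ball.1 hw).le
  have h := Complex.norm_fderiv_le_div_of_mapsTo_ball (R₂ := 2 * (C * ‖f‖))
    ((holo_differentiableOn f).mono (hb.trans hδΩ)) (fun w hw => ?_) hδ
  · exact h.trans (le_of_eq (by ring))
  · rw [mem_closedBall, dist_eq_norm]
    have h1 := hC f w (hb hw)
    have h2 := hC f z (hb (mem_ball_self hδ))
    exact (norm_sub_le _ _).trans (by linarith)

theorem isClosed_bergmanSpace :
    IsClosed (bergmanSpace Ω : Set (Lp ℂ 2 (volume.restrict (Ω : Set (Fin d → ℂ))))) := by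
  refine IsSeqClosed.isClosed fun F f hF hlim => ?_
  set G : ℕ → bergmanSpace Ω := fun n => ⟨F n, hF n⟩ with hG
  have hGc : CauchySeq G := by
    have hFc := hlim.cauchySeq
    rw [Metric.cauchySeq_iff] at hFc ⊢
    exact hFc
  have hdiff : ∀ (m n : ℕ) (z : Fin d → ℂ), z ∈ Ω →
      fderiv ℂ (holo (G m)) z - fderiv ℂ (holo (G n)) z = fderiv ℂ (holo (G m - G n)) z := by
    intro m n z hz
    rw [holo_sub]
    exact (fderiv_sub ((holo_differentiableOn (G m)).differentiableAt (Ω.isOpen.mem_nhds hz))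
      ((holo_differentiableOn (G n)).differentiableAt (Ω.isOpen.mem_nhds hz))).symm
  have hval : ∀ z ∈ Ω, ∃ y, Tendsto (fun n => holo (G n) z) atTop (𝓝 y) := by
    intro z hz
    obtain ⟨C, hC0, hC⟩ := exists_norm_holo_le (Ω := Ω) (isCompact_singleton (x := z))
      (singleton_subset_iff.2 hz)
    apply cauchySeq_tendsto_of_complete
    rw [Metric.cauchySeq_iff] at hGc ⊢
    intro ε hε
    obtain ⟨N, hN⟩ := hGc (ε / (C + 1)) (by positivity)
    refine ⟨N, fun m hm n hn => ?_⟩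
    have h1 := hC (G m - G n) z rfl
    have h2 := hN m hm n hn
    rw [dist_eq_norm, lt_div_iff₀ (by positivity)] at h2
    rw [dist_eq_norm]
    rw [holo_sub, Pi.sub_apply] at h1
    nlinarith [norm_nonneg (G m - G n)]
  have hucs : ∀ K : Set (Fin d → ℂ), IsCompact K → K ⊆ Ω →
      UniformCauchySeqOn (fun n => fderiv ℂ (holo (G n))) atTop K := by
    intro K hK hKΩ
    obtain ⟨C, hC0, hC⟩ := exists_norm_fderiv_holo_le hK hKΩ
    rw [Metric.uniformCauchySeqOn_iff]
    rw [Metric.cauchySeq_iff] at hGc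
    intro ε hε
    obtain ⟨N, hN⟩ := hGc (ε / (C + 1)) (by positivity)
    refine ⟨N, fun m hm n hn z hz => ?_⟩
    have h1 := hC (G m - G n) z hz
    have h2 := hN m hm n hn
    rw [dist_eq_norm, lt_div_iff₀ (by positivity)] at h2
    rw [dist_eq_norm, hdiff m n z (hKΩ hz)]
    nlinarith [norm_nonneg (G m - G n)]
  have hder : ∀ z ∈ Ω, ∃ y, Tendsto (fun n => fderiv ℂ (holo (G n)) z) atTop (𝓝 y) := by
    intro z hz
    exact cauchySeq_tendsto_of_complete
      ((hucs {z} isCompact_singleton (singleton_subset_iff.2 hz)).cauchySeq rfl)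
  choose! g hg using hval
  choose! g' hg' using hder
  have hloc : TendstoLocallyUniformlyOn (fun n => fderiv ℂ (holo (G n))) g' atTop Ω := by
    rw [tendstoLocallyUniformlyOn_iff_forall_isCompact Ω.isOpen]
    intro K hKΩ hK
    exact (hucs K hK hKΩ).tendstoUniformlyOn_of_tendsto fun z hz => hg' z (hKΩ hz)
  refine ⟨g, fun z hz => ?_, ?_⟩
  · exact (hasFDerivAt_of_tendsto_locally_uniformly_on' Ω.isOpen hloc
      (fun n => holo_differentiableOn (G n)) hg hz).differentiableAt.differentiableWithinAt
  · obtain ⟨ns, hns, hae⟩ := (tendstoInMeasure_of_tendsto_Lp hlim).exists_seq_tendsto_ae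
    have hall : ∀ᵐ z ∂(volume.restrict (Ω : Set (Fin d → ℂ))), ∀ n, F n z = holo (G n) z :=
      ae_all_iff.2 fun n => coe_ae_eq_holo (G n)
    filter_upwards [hae, hall, ae_restrict_mem Ω.isOpen.measurableSet] with z h1 h2 hz
    refine tendsto_nhds_unique h1 ?_
    simp_rw [h2]
    exact (hg z hz).comp hns.tendsto_atTop

instance : CompleteSpace (bergmanSpace Ω) :=
  (isClosed_bergmanSpace (Ω := Ω)).completeSpace_coe

/-- Evaluation at `z`, as a bounded linear functional on the Bergman space. -/
def evalCLM (Ω : Opens (Fin d → ℂ)) (z : Fin d → ℂ) : bergmanSpace Ω →L[ℂ] ℂ :=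
  LinearMap.mkContinuousOfExistsBound
    { toFun := fun f => holo f z
      map_add' := fun f g => by rw [holo_add]; rfl
      map_smul' := fun c f => by rw [holo_smul]; rfl } (by
    by_cases hz : z ∈ Ω
    · obtain ⟨C, -, hC⟩ := exists_norm_holo_le (Ω := Ω) (isCompact_singleton (x := z))
        (singleton_subset_iff.2 hz)
      exact ⟨C, fun f => hC f z rfl⟩
    · exact ⟨0, fun f => by simp [holo_of_notMem f hz]⟩)

/-- The element of the Bergman space that represents evaluation at `w`. -/
def kernelVec (Ω : Opens (Fin d → ℂ)) (w : Fin d → ℂ) : bergmanSpace Ω :=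
  (InnerProductSpace.toDual ℂ (bergmanSpace Ω)).symm (evalCLM Ω w)

theorem inner_kernelVec (w : Fin d → ℂ) (f : bergmanSpace Ω) :
    inner ℂ (kernelVec Ω w) f = holo f w :=
  InnerProductSpace.toDual_symm_apply

/-- The Bergman kernel `B(z, w)` of `Ω` (it is `0` unless `z` and `w` are in `Ω`). -/
def bergmanKernel (Ω : Opens (Fin d → ℂ)) (z w : Fin d → ℂ) : ℂ :=
  holo (kernelVec Ω w) z

theorem bergmanKernel_conj (z w : Fin d → ℂ) :
    bergmanKernel Ω z w = conj (bergmanKernel Ω w z) := by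
  rw [bergmanKernel, bergmanKernel, ← inner_kernelVec, ← inner_kernelVec]
  exact (inner_conj_symm (𝕜 := ℂ) (kernelVec Ω z) (kernelVec Ω w)).symm

/-- The Bergman kernel is the integral kernel of the orthogonal projection of `L²(Ω)` onto the
Bergman space. -/
theorem holo_projection_eq_integral (f : Lp ℂ 2 (volume.restrict (Ω : Set (Fin d → ℂ))))
    (z : Fin d → ℂ) :
    holo ((bergmanSpace Ω).orthogonalProjectionOnto f) z =
      ∫ w in (Ω : Set (Fin d → ℂ)), bergmanKernel Ω z w * f w := by
  rw [← inner_kernelVec, Submodule.inner_orthogonalProjectionOnto_eq_of_mem_left, L2.inner_def]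
  refine integral_congr_ae ?_
  filter_upwards [coe_ae_eq_holo (kernelVec Ω z)] with w hw
  rw [hw, RCLike.inner_apply, bergmanKernel_conj, bergmanKernel, mul_comm]

/-! ### The Toeplitz operator -/

theorem ae_mem_of_support {μ : ComplexMeasure (Fin d → ℂ)} {K : Set (Fin d → ℂ)}
    (hK : IsCompact K) (h : ∀ s, MeasurableSet s → Disjoint s K → μ s = 0) :
    ∀ᵐ z ∂(VectorMeasure.variation μ), z ∈ K := by
  rw [ae_iff]
  exact (VectorMeasure.variation_apply_eq_zero hK.isClosed.measurableSet.compl).2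
    fun t ht htm => h t htm (disjoint_compl_left.mono_left ht)

theorem integrable_holo_mul_conj_holo {μ : ComplexMeasure (Fin d → ℂ)}
    (hμ : HasCompactSupportIn μ Ω) (u v : bergmanSpace Ω) :
    Integrable (fun w => holo u w * conj (holo v w)) (VectorMeasure.variation μ) := by
  obtain ⟨K, hK, hKΩ, hμK⟩ := hμ
  obtain ⟨C, hC0, hC⟩ := exists_norm_holo_le hK hKΩ
  have := isFiniteMeasure_variation μ
  refine Integrable.of_bound ((measurable_holo u).mul
    (Complex.continuous_conj.measurable.comp (measurable_holo v))).aestronglyMeasurable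
    (C * ‖u‖ * (C * ‖v‖)) ?_
  filter_upwards [ae_mem_of_support hK hμK] with w hw
  change ‖holo u w * conj (holo v w)‖ ≤ _
  rw [norm_mul, RCLike.norm_conj]
  exact mul_le_mul (hC u w hw) (hC v w hw) (norm_nonneg _) (by positivity)

/-- The form `(u, v) ↦ ∫ u conj(v) dμ` is represented by a vector of the Bergman space. -/
theorem exists_toeplitz_repr {μ : ComplexMeasure (Fin d → ℂ)} (hμ : HasCompactSupportIn μ Ω)
    (u : bergmanSpace Ω) : ∃ t : bergmanSpace Ω, ∀ v : bergmanSpace Ω,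
      inner ℂ v t = cintegral μ fun w => holo u w * conj (holo v w) := by
  have hint := integrable_holo_mul_conj_holo hμ u
  obtain ⟨K, hK, hKΩ, hμK⟩ := hμ
  obtain ⟨C, hC0, hC⟩ := exists_norm_holo_le hK hKΩ
  let L : bergmanSpace Ω →L[ℂ] ℂ := LinearMap.mkContinuousOfExistsBound
    { toFun := fun v => conj (cintegral μ fun w => holo u w * conj (holo v w))
      map_add' := fun v v' => by
        rw [← map_add, ← cintegral_add μ (hint v) (hint v')]
        congr 2
        funext w
        rw [holo_add, Pi.add_apply, map_add, mul_add]
      map_smul' := fun c v => by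
        rw [RingHom.id_apply, smul_eq_mul, ← Complex.conj_conj c, ← map_mul, Complex.conj_conj,
          ← cintegral_const_mul]
        congr 2
        funext w
        rw [holo_smul, Pi.smul_apply, smul_eq_mul, map_mul, mul_left_comm] } (by
      refine ⟨C * ‖u‖ * C * (‖ContinuousLinearMap.mul ℝ ℂ‖ *
        (VectorMeasure.variation μ).real univ), fun v => ?_⟩
      change ‖conj (cintegral μ fun w => holo u w * conj (holo v w))‖ ≤ _
      rw [RCLike.norm_conj]
      refine (norm_cintegral_le μ (C := C * ‖u‖ * (C * ‖v‖)) ?_).trans (le_of_eq (by ring))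
      filter_upwards [ae_mem_of_support hK hμK] with w hw
      rw [norm_mul, RCLike.norm_conj]
      exact mul_le_mul (hC u w hw) (hC v w hw) (norm_nonneg _) (by positivity))
  refine ⟨(InnerProductSpace.toDual ℂ (bergmanSpace Ω)).symm L, fun v => ?_⟩
  refine (inner_conj_symm (𝕜 := ℂ) v ((InnerProductSpace.toDual ℂ (bergmanSpace Ω)).symm L)).symm.trans
    ?_
  rw [InnerProductSpace.toDual_symm_apply]
  exact Complex.conj_conj _

theorem exists_toeplitz {μ : ComplexMeasure (Fin d → ℂ)} (hμ : HasCompactSupportIn μ Ω)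
    (u : bergmanSpace Ω) : ∃ t : bergmanSpace Ω, ∀ z ∈ Ω,
      holo t z = cintegral μ fun w => bergmanKernel Ω z w * holo u w := by
  obtain ⟨t, ht⟩ := exists_toeplitz_repr hμ u
  refine ⟨t, fun z _ => ?_⟩
  rw [← inner_kernelVec, ht]
  congr 1
  funext w
  rw [bergmanKernel_conj, bergmanKernel, mul_comm]

theorem toeplitz_differentiableOn {μ : ComplexMeasure (Fin d → ℂ)} (hμ : HasCompactSupportIn μ Ω)
    (u : bergmanSpace Ω) :
    DifferentiableOn ℂ (fun z => cintegral μ fun w => bergmanKernel Ω z w * holo u w) Ω := by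
  obtain ⟨t, ht⟩ := exists_toeplitz hμ u
  exact (holo_differentiableOn t).congr fun z hz => (ht z hz).symm

theorem toeplitz_memLp {μ : ComplexMeasure (Fin d → ℂ)} (hμ : HasCompactSupportIn μ Ω)
    (u : bergmanSpace Ω) :
    MemLp (fun z => cintegral μ fun w => bergmanKernel Ω z w * holo u w) 2
      (volume.restrict (Ω : Set (Fin d → ℂ))) := by
  obtain ⟨t, ht⟩ := exists_toeplitz hμ u
  refine (memLp_congr_ae ?_).1 (Lp.memLp (t : Lp ℂ 2 (volume.restrict (Ω : Set (Fin d → ℂ)))))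
  filter_upwards [coe_ae_eq_holo t, ae_restrict_mem Ω.isOpen.measurableSet] with z hz hzΩ
  rw [hz, ht z hzΩ]

theorem integrable_kernel_mul_holo {μ : ComplexMeasure (Fin d → ℂ)}
    (hμ : HasCompactSupportIn μ Ω) (z : Fin d → ℂ) (u : bergmanSpace Ω) :
    Integrable (fun w => bergmanKernel Ω z w * holo u w) (VectorMeasure.variation μ) := by
  have h := integrable_holo_mul_conj_holo hμ u (kernelVec Ω z)
  refine h.congr (Eventually.of_forall fun w => ?_)
  change holo u w * conj (holo (kernelVec Ω z) w) = bergmanKernel Ω z w * holo u w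
  rw [bergmanKernel_conj, bergmanKernel, mul_comm]

/-- The Toeplitz operator `(T u)(z) = ∫ B(z, w) u(w) dμ(w)` on the Bergman space of `Ω`. -/
def toeplitz (Ω : Opens (Fin d → ℂ)) (μ : ComplexMeasure (Fin d → ℂ))
    (hμ : HasCompactSupportIn μ Ω) : bergmanSpace Ω →ₗ[ℂ] bergmanSpace Ω where
  toFun u := ⟨(toeplitz_memLp hμ u).toLp
      (fun z => cintegral μ fun w => bergmanKernel Ω z w * holo u w),
    _, toeplitz_differentiableOn hμ u, MemLp.coeFn_toLp _⟩
  map_add' u v := by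
    apply Subtype.ext
    rw [Submodule.coe_add, ← MemLp.toLp_add]
    refine MemLp.toLp_congr (toeplitz_memLp hμ (u + v))
      ((toeplitz_memLp hμ u).add (toeplitz_memLp hμ v)) (Eventually.of_forall fun z => ?_)
    change cintegral μ (fun w => bergmanKernel Ω z w * holo (u + v) w) = _ + _
    rw [← cintegral_add μ (integrable_kernel_mul_holo hμ z u) (integrable_kernel_mul_holo hμ z v)]
    congr 1
    funext w
    rw [holo_add, Pi.add_apply, mul_add]
  map_smul' c u := by
    apply Subtype.ext
    rw [Submodule.coe_smul, RingHom.id_apply, ← MemLp.toLp_const_smul]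
    refine MemLp.toLp_congr (toeplitz_memLp hμ (c • u))
      ((toeplitz_memLp hμ u).const_smul c) (Eventually.of_forall fun z => ?_)
    change cintegral μ (fun w => bergmanKernel Ω z w * holo (c • u) w) = c * _
    rw [← cintegral_const_mul]
    congr 1
    funext w
    rw [holo_smul, Pi.smul_apply, smul_eq_mul, mul_left_comm]

theorem holo_toeplitz {μ : ComplexMeasure (Fin d → ℂ)} (hμ : HasCompactSupportIn μ Ω)
    (u : bergmanSpace Ω) {z : Fin d → ℂ} (hz : z ∈ Ω) :
    holo (toeplitz Ω μ hμ u) z = cintegral μ fun w => bergmanKernel Ω z w * holo u w :=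
  holo_eqOn_of_ae_eq _ (toeplitz_differentiableOn hμ u)
    (MemLp.coeFn_toLp (toeplitz_memLp hμ u)) hz

/-- The sesquilinear form of the Toeplitz operator. -/
theorem inner_toeplitz {μ : ComplexMeasure (Fin d → ℂ)} (hμ : HasCompactSupportIn μ Ω)
    (u v : bergmanSpace Ω) :
    inner ℂ v (toeplitz Ω μ hμ u) = cintegral μ fun w => holo u w * conj (holo v w) := by
  obtain ⟨t, ht⟩ := exists_toeplitz_repr hμ u
  have h : toeplitz Ω μ hμ u = t := by
    apply Subtype.ext
    apply Lp.ext
    filter_upwards [coe_ae_eq_holo t, coe_ae_eq_holo (toeplitz Ω μ hμ u),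
      ae_restrict_mem Ω.isOpen.measurableSet] with z h1 h2 hz
    rw [h1, h2, holo_toeplitz hμ u hz, ← inner_kernelVec z t, ht]
    congr 1
    funext w
    rw [bergmanKernel_conj, bergmanKernel, mul_comm]
  rw [h, ht]

/-- The rank of a linear map, as an element of `{0, 1, 2, …, ∞}`. -/
def eRank {V W : Type*} [AddCommGroup V] [Module ℂ V] [AddCommGroup W] [Module ℂ W]
    (T : V →ₗ[ℂ] W) : ℕ∞ :=
  Cardinal.toENat T.rank

end

end BergmanToeplitz

/-! Both ranks are compared with the number of points in the support of the variation `|μ|`, through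
a cycle of inequalities rank A ≤ rank T ≤ #supp ≤ rank A.

The first two are linear algebra on the form `⟨v, T u⟩ = ∫ u conj(v) dμ`. Since `Ω` is bounded,
monomials lie in the Bergman space and the moments are the numbers `⟨z^β, T z^α⟩`, so A is a
compression of T (`eRank_momentMatrix_le`). And `T u` depends only on the values of `u` on a set
carrying `|μ|`, so T factors through evaluation there (`eRank_toeplitz_le_encard`).

The third is Luecking's theorem (`not_injective_of_forall_det_eq_zero`). Write `μ = h|μ|` with `|h|
= 1`. If all `n × n` minors of A vanish, expanding the determinant shows that the product measure
`μ^n` on `(ℂ^d)^n` annihilates `P conj(Q)` for every polynomial P and every antisymmetric polynomial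
Q. Fix an antisymmetric W and use `PW` and `QW` with P, Q symmetric: the measure `|W|² μ^n`
annihilates all `P conj(Q)` with P, Q symmetric. These span a star algebra separating the orbits of
the symmetric group, so by Stone-Weierstrass the measure annihilates all symmetric continuous
functions; being itself symmetric, it is zero. Hence every antisymmetric W vanishes almost
everywhere for `|μ|^n`. With n distinct points in the support, a suitable determinant
`det(g_j(z_i))` is nonzero near that n-tuple, a contradiction. -/

namespace BergmanToeplitz

open MeasureTheory Set Filter Topology TopologicalSpace
open scoped ENNReal ComplexConjugate

/-! ### Complex measures as unimodular densities against their variation. -/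

section Density

variable {X : Type*} [MeasurableSpace X]

/-- Polar decomposition of a complex measure. -/
theorem exists_polar_density (μ : ComplexMeasure X) :
    ∃ h : X → ℂ, Measurable h ∧ (∀ᵐ x ∂(VectorMeasure.variation μ), ‖h x‖ = 1) ∧
      ∀ s, MeasurableSet s → μ s = ∫ x in s, h x ∂(VectorMeasure.variation μ) := by
  have := isFiniteMeasure_variation μ
  set ν := VectorMeasure.variation μ with hν
  have hac : ∀ s, ν s = 0 → μ s = 0 := fun s hs => by
    have := VectorMeasure.enorm_measure_le_variation μ s
    rw [← hν, hs] at this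
    simpa using this
  have hre : ComplexMeasure.re μ ≪ᵥ ν.toENNRealVectorMeasure := by
    refine VectorMeasure.AbsolutelyContinuous.mk fun s hs h0 => ?_
    rw [Measure.toENNRealVectorMeasure_apply_measurable hs] at h0
    change (μ s).re = 0
    simp [hac s h0]
  have him : ComplexMeasure.im μ ≪ᵥ ν.toENNRealVectorMeasure := by
    refine VectorMeasure.AbsolutelyContinuous.mk fun s hs h0 => ?_
    rw [Measure.toENNRealVectorMeasure_apply_measurable hs] at h0
    change (μ s).im = 0
    simp [hac s h0]
  have hi : Integrable (μ.rnDeriv ν) ν := ComplexMeasure.integrable_rnDeriv μ ν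
  have hμ : ∀ s, MeasurableSet s → μ s = ∫ x in s, μ.rnDeriv ν x ∂ν := by
    intro s hs
    have h1 := SignedMeasure.withDensityᵥ_rnDeriv_eq _ ν hre
    have h2 := SignedMeasure.withDensityᵥ_rnDeriv_eq _ ν him
    have h1' := congrArg (fun m : SignedMeasure X => m s) h1
    have h2' := congrArg (fun m : SignedMeasure X => m s) h2
    beta_reduce at h1' h2'
    rw [withDensityᵥ_apply (SignedMeasure.integrable_rnDeriv _ _) hs] at h1' h2'
    apply Complex.ext
    · rw [← RCLike.re_eq_complex_re, ← integral_re hi.integrableOn]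
      exact h1'.symm
    · rw [← RCLike.im_eq_complex_im, ← integral_im hi.integrableOn]
      exact h2'.symm
  have hw : ν.withDensityᵥ (μ.rnDeriv ν) = μ := by
    ext s hs
    rw [withDensityᵥ_apply hi hs, hμ s hs]
  -- The variation of a measure with density `f` against `ν` has density `|f|`. Here that variation
  -- is `ν` itself, which forces `|f| = 1` almost everywhere.
  have hv := Measure.variation_withDensityᵥ hi
  rw [hw, ← hν] at hv
  have hm : Measurable (μ.rnDeriv ν) := by
    have h1 : Measurable fun x => (μ.rnDeriv ν x).re :=
      SignedMeasure.measurable_rnDeriv _ _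
    have h2 : Measurable fun x => (μ.rnDeriv ν x).im :=
      SignedMeasure.measurable_rnDeriv _ _
    exact measurable_of_re_im h1 h2
  refine ⟨μ.rnDeriv ν, hm, ?_, hμ⟩
  have : ν.withDensity 1 = ν.withDensity (fun x => ‖μ.rnDeriv ν x‖ₑ) := by
    rw [withDensity_one]; exact hv
  have h1 := (withDensity_eq_iff (μ := ν) (f := 1) (g := fun x => ‖μ.rnDeriv ν x‖ₑ)
    aemeasurable_const hm.enorm.aemeasurable (by simp)).1 this
  filter_upwards [h1] with x hx
  rw [← toReal_enorm, ← hx]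
  simp

/-- Passing to a Bochner integral against a positive measure makes product measures and Fubini
available. The two sides agree on indicators, are additive, and are continuous in the L¹ norm
because `|h| = 1`, so density of simple functions suffices. -/
theorem cintegral_eq_integral_mul {μ : ComplexMeasure X} {h : X → ℂ} (hm : Measurable h)
    (h1 : ∀ᵐ x ∂(VectorMeasure.variation μ), ‖h x‖ = 1)
    (hμ : ∀ s, MeasurableSet s → μ s = ∫ x in s, h x ∂(VectorMeasure.variation μ))
    {f : X → ℂ} (hf : Integrable f (VectorMeasure.variation μ)) :
    cintegral μ f = ∫ x, f x * h x ∂(VectorMeasure.variation μ) := by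
  have := isFiniteMeasure_variation μ
  set ν := VectorMeasure.variation μ with hν
  have hmul : ∀ {g : X → ℂ}, Integrable g ν → Integrable (fun x => g x * h x) ν := fun hg =>
    hg.mul_bdd (c := 1) hm.aestronglyMeasurable (h1.mono fun x hx => hx.le)
  refine Integrable.induction (fun f => cintegral μ f = ∫ x, f x * h x ∂ν) ?_ ?_ ?_ ?_ hf
  · intro c s hs _
    have e1 : cintegral μ (s.indicator fun _ => c) = c * μ s :=
      VectorMeasure.integral_indicator_const c hs
    rw [e1, hμ s hs, ← integral_const_mul, ← integral_indicator hs]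
    congr 1
    funext x
    by_cases hx : x ∈ s <;> simp [hx]
  · intro f g _ hf hg ihf ihg
    have e : cintegral μ (f + g) = cintegral μ f + cintegral μ g := cintegral_add μ hf hg
    rw [e, ihf, ihg, ← integral_add (hmul hf) (hmul hg)]
    simp only [Pi.add_apply, add_mul]
  · refine isClosed_eq VectorMeasure.continuous_integral ?_
    have : LipschitzWith 1 fun f : X →₁[ν] ℂ => ∫ x, f x * h x ∂ν := by
      refine LipschitzWith.of_dist_le_mul fun f g => ?_
      rw [NNReal.coe_one, one_mul, dist_eq_norm, dist_eq_norm,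
        ← integral_sub (hmul (L1.integrable_coeFn f)) (hmul (L1.integrable_coeFn g)),
        L1.norm_eq_integral_norm]
      refine (norm_integral_le_integral_norm _).trans (le_of_eq (integral_congr_ae ?_))
      filter_upwards [h1, Lp.coeFn_sub f g] with x hx hfg
      rw [← sub_mul, norm_mul, hx, mul_one]
      exact congrArg norm hfg.symm
    exact this.continuous
  · intro f g hfg _ ih
    have e : cintegral μ f = cintegral μ g := VectorMeasure.integral_congr_ae hfg
    rw [← e, ih]
    exact integral_congr_ae (hfg.mono fun x hx => by simp only [hx])

end Density

/-! ### Stone-Weierstrass modulo the points that an algebra does not separate. -/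

section StoneWeierstrass

/-- The Stone-Weierstrass theorem for a star subalgebra that need not separate points. -/
theorem mem_topologicalClosure_of_forall_eq {X : Type*} [TopologicalSpace X] [CompactSpace X]
    (A : StarSubalgebra ℂ C(X, ℂ)) (Φ : C(X, ℂ))
    (hΦ : ∀ x y, (∀ a ∈ A, a x = a y) → Φ x = Φ y) : Φ ∈ A.topologicalClosure := by
  -- Points not separated by `A` are identified. The functions in `A` embed the quotient
  -- continuously into `ℂ^A`, so it is compact Hausdorff, and there `A` descends to a
  -- point-separating algebra `B`.
  let r : Setoid X :=
    { r := fun x y => ∀ a ∈ A, a x = a y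
      iseqv := ⟨fun _ _ _ => rfl, fun h a ha => (h a ha).symm,
        fun h h' a ha => (h a ha).trans (h' a ha)⟩ }
  let q : C(X, Quotient r) := ⟨Quotient.mk r, continuous_quotient_mk'⟩
  let ev : Quotient r → A → ℂ := fun y a => Quotient.lift (fun x => a.1 x) (fun x y h =>
    (show ∀ a ∈ A, a x = a y from h) a.1 a.2) y
  have hev : Continuous ev := by
    refine continuous_pi fun a => ?_
    exact a.1.continuous.quotient_lift _
  have hinj : Function.Injective ev := by
    intro y y' h
    induction y using Quotient.inductionOn with | _ x
    induction y' using Quotient.inductionOn with | _ x'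
    exact Quotient.sound fun a ha => congrFun h ⟨a, ha⟩
  have : T2Space (Quotient r) := T2Space.of_injective_continuous hinj hev
  let B : StarSubalgebra ℂ C(Quotient r, ℂ) := A.comap (ContinuousMap.compStarAlgHom' ℂ ℂ q)
  have hB : B.toSubalgebra.SeparatesPoints := by
    intro y y' hne
    induction y using Quotient.inductionOn with | _ x
    induction y' using Quotient.inductionOn with | _ x'
    have : ¬ ∀ a ∈ A, a x = a x' := fun h => hne (Quotient.sound h)
    push Not at this
    obtain ⟨a, ha, hax⟩ := this
    refine ⟨_, ⟨⟨fun y => ev y ⟨a, ha⟩, (continuous_apply _).comp hev⟩, ?_, rfl⟩, hax⟩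
    exact ha
  have htop := ContinuousMap.starSubalgebra_topologicalClosure_eq_top_of_separatesPoints B hB
  let Ψ : C(Quotient r, ℂ) := ⟨Quotient.lift Φ hΦ, Φ.continuous.quotient_lift _⟩
  have hΨ : Ψ ∈ closure (B : Set C(Quotient r, ℂ)) := by
    have : Ψ ∈ B.topologicalClosure := htop ▸ StarSubalgebra.mem_top
    exact this
  have hm := map_mem_closure (ContinuousMap.continuous_precomp q) hΨ
    (t := (A : Set C(X, ℂ))) (fun b hb => hb)
  exact hm

end StoneWeierstrass

/-! ### Symmetric and antisymmetric polynomials in n vector variables. -/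

section Polynomials

variable {d n : ℕ}

/-- The value at a point of `(ℂ^d)^n` of a polynomial in `n` groups of `d` variables. -/
noncomputable def polyEval (z : Fin n → Fin d → ℂ) (P : MvPolynomial (Fin n × Fin d) ℂ) : ℂ :=
  MvPolynomial.eval (fun p => z p.1 p.2) P

theorem continuous_polyEval (P : MvPolynomial (Fin n × Fin d) ℂ) :
    Continuous fun z : Fin n → Fin d → ℂ => polyEval z P := by
  have h : Continuous fun z : Fin n → Fin d → ℂ => fun p : Fin n × Fin d => z p.1 p.2 := by
    fun_prop
  exact (MvPolynomial.continuous_eval P).comp h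

theorem polyEval_monomial (z : Fin n → Fin d → ℂ) (u : Fin n × Fin d →₀ ℕ) (a : ℂ) :
    polyEval z (MvPolynomial.monomial u a) = a * ∏ i, ∏ k, z i k ^ u (i, k) := by
  rw [polyEval, MvPolynomial.eval_monomial, Finsupp.prod_fintype _ _ (fun _ => pow_zero _),
    Fintype.prod_prod_type]

/-- Invariance of a polynomial under permutations of the groups of variables. -/
def IsSymm (P : MvPolynomial (Fin n × Fin d) ℂ) : Prop :=
  ∀ (s : Equiv.Perm (Fin n)) (z : Fin n → Fin d → ℂ), polyEval (z ∘ s) P = polyEval z P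

/-- Antisymmetry of a polynomial under permutations of the groups of variables. -/
def IsAntisymm (P : MvPolynomial (Fin n × Fin d) ℂ) : Prop :=
  ∀ (s : Equiv.Perm (Fin n)) (z : Fin n → Fin d → ℂ),
    polyEval (z ∘ s) P = (Equiv.Perm.sign s : ℂ) * polyEval z P

theorem IsSymm.mul_isAntisymm {P Q : MvPolynomial (Fin n × Fin d) ℂ} (hP : IsSymm P)
    (hQ : IsAntisymm Q) : IsAntisymm (P * Q) := by
  intro s z
  have h1 := hP s z
  have h2 := hQ s z
  simp only [polyEval, map_mul] at *
  rw [h1, h2, mul_left_comm]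

theorem polyEval_rename (z : Fin n → Fin d → ℂ) (i : Fin n) (f : MvPolynomial (Fin d) ℂ) :
    polyEval z (MvPolynomial.rename (fun k => (i, k)) f) = MvPolynomial.eval (z i) f := by
  rw [polyEval, MvPolynomial.eval_rename]
  rfl

/-- The power sum `∑ᵢ f(zᵢ)`. -/
noncomputable def powerSum (n : ℕ) (f : MvPolynomial (Fin d) ℂ) : MvPolynomial (Fin n × Fin d) ℂ :=
  ∑ i, MvPolynomial.rename (fun k => (i, k)) f

theorem polyEval_powerSum (z : Fin n → Fin d → ℂ) (f : MvPolynomial (Fin d) ℂ) :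
    polyEval z (powerSum n f) = ∑ i, MvPolynomial.eval (z i) f := by
  simp_rw [← polyEval_rename]
  simp [polyEval, powerSum]

theorem isSymm_powerSum (f : MvPolynomial (Fin d) ℂ) : IsSymm (powerSum n f) := by
  intro s z
  rw [polyEval_powerSum, polyEval_powerSum]
  exact Equiv.sum_comp s fun i => MvPolynomial.eval (z i) f

/-- The determinant `det (gⱼ(zᵢ))`. -/
noncomputable def detPoly (g : Fin n → MvPolynomial (Fin d) ℂ) : MvPolynomial (Fin n × Fin d) ℂ :=
  Matrix.det (Matrix.of fun i j => MvPolynomial.rename (fun k => (i, k)) (g j))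

theorem polyEval_detPoly (z : Fin n → Fin d → ℂ) (g : Fin n → MvPolynomial (Fin d) ℂ) :
    polyEval z (detPoly g) = Matrix.det (Matrix.of fun i j => MvPolynomial.eval (z i) (g j)) := by
  rw [polyEval, detPoly, RingHom.map_det]
  congr 1
  ext i j
  exact polyEval_rename z i (g j)

theorem isAntisymm_detPoly (g : Fin n → MvPolynomial (Fin d) ℂ) : IsAntisymm (detPoly g) := by
  intro s z
  rw [polyEval_detPoly, polyEval_detPoly, ← Matrix.det_permute]
  rfl

/-- A polynomial that vanishes on a finite set except at a given point. -/
theorem exists_eval_ne_zero (S : Finset (Fin d → ℂ)) (a : Fin d → ℂ) :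
    ∃ f : MvPolynomial (Fin d) ℂ, MvPolynomial.eval a f ≠ 0 ∧
      ∀ b ∈ S, b ≠ a → MvPolynomial.eval b f = 0 := by
  classical
  have h : ∀ b : Fin d → ℂ, ∃ f : MvPolynomial (Fin d) ℂ, MvPolynomial.eval b f = 0 ∧
      (b ≠ a → MvPolynomial.eval a f ≠ 0) := by
    intro b
    by_cases hb : b = a
    · exact ⟨0, by simp, fun h => absurd hb h⟩
    · obtain ⟨k, hk⟩ := Function.ne_iff.1 hb
      exact ⟨MvPolynomial.X k - MvPolynomial.C (b k), by simp, fun _ => by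
        simpa [sub_eq_zero] using Ne.symm hk⟩
  choose f hf0 hf using h
  refine ⟨∏ b ∈ S.erase a, f b, ?_, fun b hb hba => ?_⟩
  · rw [map_prod, Finset.prod_ne_zero_iff]
    exact fun b hb => hf b (Finset.ne_of_mem_erase hb)
  · rw [map_prod]
    exact Finset.prod_eq_zero (Finset.mem_erase.2 ⟨hba, hb⟩) (hf0 b)

/-- Symmetric polynomials separate the orbits of the symmetric group. -/
theorem exists_perm_of_isSymm {x y : Fin n → Fin d → ℂ}
    (h : ∀ P, IsSymm P → polyEval x P = polyEval y P) : ∃ s : Equiv.Perm (Fin n), x = y ∘ s := by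
  classical
  have hcard : ∀ a, Fintype.card {i // x i = a} = Fintype.card {i // y i = a} := by
    intro a
    -- Such an `f` kills every entry of `x` and `y` other than `a`, so its power sum is `f(a)` times
    -- the multiplicity of `a`. Equal power sums thus give equal multiplicities, and bijections
    -- between the fibres of `x` and `y` glue to a permutation.
    obtain ⟨f, hfa, hf⟩ := exists_eval_ne_zero
      (Finset.univ.image x ∪ Finset.univ.image y) a
    have hsum : ∀ z : Fin n → Fin d → ℂ,
        (∀ i, z i ∈ Finset.univ.image x ∪ Finset.univ.image y) →
        polyEval z (powerSum n f) = Fintype.card {i // z i = a} * MvPolynomial.eval a f := by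
      intro z hz
      rw [polyEval_powerSum, Fintype.card_subtype, ← nsmul_eq_mul, ← Finset.sum_const,
        Finset.sum_filter]
      refine Finset.sum_congr rfl fun i _ => ?_
      split_ifs with hi
      · rw [hi]
      · exact hf _ (hz i) hi
    have e := h _ (isSymm_powerSum f)
    rw [hsum x (fun i => by simp), hsum y (fun i => by simp)] at e
    exact_mod_cast mul_right_cancel₀ hfa e
  refine ⟨Equiv.ofFiberEquiv fun a => Fintype.equivOfCardEq (hcard a), ?_⟩
  funext i
  exact (Equiv.ofFiberEquiv_map (fun a => Fintype.equivOfCardEq (hcard a)) i).symm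

end Polynomials


/-! ### Luecking's theorem: vanishing minors bound the size of the support. -/

section Luecking

variable {d n : ℕ} {ν : Measure (Fin d → ℂ)} [IsFiniteMeasure ν] {h : (Fin d → ℂ) → ℂ}
  {K : Set (Fin d → ℂ)}

theorem ae_pi_mem (hνK : ∀ᵐ z ∂ν, z ∈ K) :
    ∀ᵐ z ∂(Measure.pi fun _ : Fin n => ν), z ∈ Set.pi univ fun _ => K := by
  have : ∀ᵐ z ∂(Measure.pi fun _ : Fin n => ν), ∀ i, z i ∈ K :=
    eventually_all.2 fun i => Measure.tendsto_eval_ae_ae.eventually hνK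
  exact this.mono fun z hz i _ => hz i

theorem ae_pi_norm_prod_eq_one (h1 : ∀ᵐ z ∂ν, ‖h z‖ = 1) :
    ∀ᵐ z ∂(Measure.pi fun _ : Fin n => ν), ‖∏ i, h (z i)‖ = 1 := by
  have : ∀ᵐ z ∂(Measure.pi fun _ : Fin n => ν), ∀ i, ‖h (z i)‖ = 1 :=
    eventually_all.2 fun i =>
      (Measure.tendsto_eval_ae_ae (μ := fun _ : Fin n => ν) (i := i)).eventually h1
  filter_upwards [this] with z hz
  rw [norm_prod]
  exact Finset.prod_eq_one fun i _ => hz i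

theorem integrable_mul_prod_density (hK : IsCompact K) (hνK : ∀ᵐ z ∂ν, z ∈ K)
    (hm : Measurable h) (h1 : ∀ᵐ z ∂ν, ‖h z‖ = 1) {F : (Fin n → Fin d → ℂ) → ℂ}
    (hF : Continuous F) :
    Integrable (fun z => F z * ∏ i, h (z i)) (Measure.pi fun _ : Fin n => ν) := by
  obtain ⟨C, hC⟩ := (isCompact_univ_pi fun _ : Fin n => hK).exists_bound_of_continuousOn
    hF.continuousOn
  refine Integrable.of_bound (C := C) ?_ ?_
  · apply AEStronglyMeasurable.mul hF.aestronglyMeasurable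
    apply Measurable.aestronglyMeasurable
    fun_prop
  · filter_upwards [ae_pi_mem hνK, ae_pi_norm_prod_eq_one h1] with z hz hz1
    rw [norm_mul, hz1, mul_one]
    exact hC z hz

/-- If the `n × n` minors of the moment matrix vanish, the product measure annihilates the products
of a polynomial and the conjugate of an alternating sum. -/
theorem integral_polyEval_mul_conj_alternating (hK : IsCompact K) (hνK : ∀ᵐ z ∂ν, z ∈ K)
    (hm : Measurable h) (h1 : ∀ᵐ z ∂ν, ‖h z‖ = 1)
    (hdet : ∀ α β : Fin n → Fin d → ℕ, Matrix.det (Matrix.of fun i j =>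
      ∫ w, ((∏ k, w k ^ α i k) * ∏ k, conj (w k) ^ β j k) * h w ∂ν) = 0)
    (P Q : MvPolynomial (Fin n × Fin d) ℂ) :
    ∫ z, (polyEval z P * conj (∑ s : Equiv.Perm (Fin n),
      (Equiv.Perm.sign s : ℂ) * polyEval (z ∘ s) Q)) * ∏ i, h (z i)
        ∂(Measure.pi fun _ : Fin n => ν) = 0 := by
  have hc : ∀ (s : Equiv.Perm (Fin n)) (Q : MvPolynomial (Fin n × Fin d) ℂ),
      Continuous fun z : Fin n → Fin d → ℂ => polyEval (z ∘ s) Q := fun s Q =>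
    (continuous_polyEval Q).comp (by fun_prop)
  have hcont : ∀ P Q : MvPolynomial (Fin n × Fin d) ℂ,
      Continuous fun z : Fin n → Fin d → ℂ => polyEval z P * conj (∑ s : Equiv.Perm (Fin n),
      (Equiv.Perm.sign s : ℂ) * polyEval (z ∘ s) Q) := fun P Q =>
    (continuous_polyEval P).mul (Complex.continuous_conj.comp
      (continuous_finsetSum _ fun s _ => continuous_const.mul (hc s Q)))
  have hint := fun P Q => integrable_mul_prod_density hK hνK hm h1 (hcont P Q)
  -- The integral is additive in `P` and in `Q`, so it is enough to treat two monomials.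
  induction P using MvPolynomial.induction_on' with
  | add P P' ih ih' =>
    have := integral_add (hint P Q) (hint P' Q)
    rw [ih, ih', add_zero] at this
    rw [← this]
    congr 1
    funext z
    simp only [polyEval, map_add, add_mul]
  | monomial u a =>
  induction Q using MvPolynomial.induction_on' with
  | add Q Q' ih ih' =>
    have := integral_add (hint (MvPolynomial.monomial u a) Q) (hint (MvPolynomial.monomial u a) Q')
    rw [ih, ih', add_zero] at this
    rw [← this]
    congr 1
    funext z
    simp only [polyEval, map_add, mul_add, Finset.sum_add_distrib, add_mul]
  | monomial v b =>
  set M : Matrix (Fin n) (Fin n) ℂ := Matrix.of fun i j =>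
      ∫ w, ((∏ k, w k ^ u (i, k)) * ∏ k, conj (w k) ^ v (j, k)) * h w ∂ν with hM
  have hM0 : M.det = 0 := hdet (fun i k => u (i, k)) (fun i k => v (i, k))
  have key : ∀ z : Fin n → Fin d → ℂ, (polyEval z (MvPolynomial.monomial u a) *
      conj (∑ s : Equiv.Perm (Fin n), (Equiv.Perm.sign s : ℂ) *
        polyEval (z ∘ s) (MvPolynomial.monomial v b))) * ∏ i, h (z i) =
      ∑ s : Equiv.Perm (Fin n), a * conj b * (Equiv.Perm.sign s : ℂ) *
        -- The inverse permutation appears because the factors are regrouped by the variable `z i`,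
        -- which separates the variables for Fubini.
        ∏ i, ((∏ k, z i k ^ u (i, k)) * ∏ k, conj (z i k) ^ v (s.symm i, k)) * h (z i) := by
    intro z
    rw [map_sum, Finset.mul_sum, Finset.sum_mul]
    refine Finset.sum_congr rfl fun s _ => ?_
    rw [polyEval_monomial, polyEval_monomial, Finset.prod_mul_distrib, Finset.prod_mul_distrib]
    have e : ∏ i, ∏ k, (z ∘ s) i k ^ v (i, k) = ∏ i, ∏ k, z i k ^ v (s.symm i, k) := by
      rw [← Equiv.prod_comp s fun i => ∏ k, z i k ^ v (s.symm i, k)]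
      simp
    rw [e]
    simp only [map_mul, map_prod, map_pow, map_intCast]
    ring
  have hprod : ∀ s : Equiv.Perm (Fin n), ∀ i, Integrable
      (fun w => ((∏ k, w k ^ u (i, k)) * ∏ k, conj (w k) ^ v (s.symm i, k)) * h w) ν := by
    intro s i
    have hcw : Continuous fun w : Fin d → ℂ =>
        (∏ k, w k ^ u (i, k)) * ∏ k, conj (w k) ^ v (s.symm i, k) := by
      have := Complex.continuous_conj
      fun_prop
    obtain ⟨C, hC⟩ := hK.exists_bound_of_continuousOn hcw.continuousOn
    refine Integrable.of_bound (C := C) (hcw.aestronglyMeasurable.mul hm.aestronglyMeasurable) ?_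
    filter_upwards [hνK, h1] with w hw hw1
    rw [norm_mul, hw1, mul_one]
    exact hC w hw
  simp_rw [key]
  rw [integral_finsetSum _ fun s _ => (Integrable.fintype_prod (hprod s)).const_mul _]
  simp_rw [integral_const_mul]
  -- By Fubini each permutation contributes one term of the Leibniz expansion of `M.det`.
  have e : ∀ s : Equiv.Perm (Fin n), ∫ z : Fin n → Fin d → ℂ,
      ∏ i, ((∏ k, z i k ^ u (i, k)) * ∏ k, conj (z i k) ^ v (s.symm i, k)) * h (z i)
        ∂(Measure.pi fun _ : Fin n => ν) = ∏ i, M (s i) i := by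
    intro s
    rw [integral_fintype_prod_eq_prod (μ := fun _ : Fin n => ν)
      (fun i w => ((∏ k, w k ^ u (i, k)) * ∏ k, conj (w k) ^ v (s.symm i, k)) * h w),
      ← Equiv.prod_comp s]
    simp [hM]
  simp_rw [e, mul_assoc]
  rw [← Finset.mul_sum, ← Finset.mul_sum, ← Matrix.det_apply', hM0, mul_zero, mul_zero]

/-- The alternating sum of an antisymmetric `Q` is `n! Q`, so the preceding result applies after
division by `n!`. -/
theorem integral_polyEval_mul_conj_isAntisymm (hK : IsCompact K) (hνK : ∀ᵐ z ∂ν, z ∈ K)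
    (hm : Measurable h) (h1 : ∀ᵐ z ∂ν, ‖h z‖ = 1)
    (hdet : ∀ α β : Fin n → Fin d → ℕ, Matrix.det (Matrix.of fun i j =>
      ∫ w, ((∏ k, w k ^ α i k) * ∏ k, conj (w k) ^ β j k) * h w ∂ν) = 0)
    (P : MvPolynomial (Fin n × Fin d) ℂ) {Q : MvPolynomial (Fin n × Fin d) ℂ}
    (hQ : IsAntisymm Q) :
    ∫ z, (polyEval z P * conj (polyEval z Q)) * ∏ i, h (z i)
        ∂(Measure.pi fun _ : Fin n => ν) = 0 := by
  have e := integral_polyEval_mul_conj_alternating hK hνK hm h1 hdet P Q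
  have key : ∀ z : Fin n → Fin d → ℂ, ∑ s : Equiv.Perm (Fin n),
      (Equiv.Perm.sign s : ℂ) * polyEval (z ∘ s) Q = (n.factorial : ℂ) * polyEval z Q := by
    intro z
    have : ∀ s : Equiv.Perm (Fin n),
        (Equiv.Perm.sign s : ℂ) * polyEval (z ∘ s) Q = polyEval z Q := by
      intro s
      rw [hQ s z, ← mul_assoc, ← Int.cast_mul, ← Units.val_mul, Int.units_mul_self]
      simp
    simp_rw [this]
    simp [Fintype.card_perm]
  have e2 : ∀ z : Fin n → Fin d → ℂ, (polyEval z P * conj (∑ s : Equiv.Perm (Fin n),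
      (Equiv.Perm.sign s : ℂ) * polyEval (z ∘ s) Q)) * ∏ i, h (z i) = (n.factorial : ℂ) *
      ((polyEval z P * conj (polyEval z Q)) * ∏ i, h (z i)) := by
    intro z
    rw [key, map_mul, Complex.conj_natCast]
    ring
  simp_rw [e2] at e
  rw [integral_const_mul] at e
  exact (mul_eq_zero.1 e).resolve_left (by exact_mod_cast n.factorial_ne_zero)

/-- On the compact set `K^n`, symmetric polynomials and their conjugates generate a star algebra
whose uniform closure contains every symmetric continuous function, since symmetric polynomials
already separate orbits. Integration against `G` is continuous for the uniform norm. -/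
theorem integral_mul_eq_zero_of_symmetric (hK : IsCompact K) (hνK : ∀ᵐ z ∂ν, z ∈ K)
    {G : (Fin n → Fin d → ℂ) → ℂ} (hG : Integrable G (Measure.pi fun _ : Fin n => ν))
    (hPQ : ∀ P Q : MvPolynomial (Fin n × Fin d) ℂ, IsSymm P → IsSymm Q →
      ∫ z, (polyEval z P * conj (polyEval z Q)) * G z ∂(Measure.pi fun _ : Fin n => ν) = 0)
    {Φ : (Fin n → Fin d → ℂ) → ℂ} (hΦ : Continuous Φ)
    (hΦs : ∀ (s : Equiv.Perm (Fin n)) z, Φ (z ∘ s) = Φ z) :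
    ∫ z, Φ z * G z ∂(Measure.pi fun _ : Fin n => ν) = 0 := by
  set X : Set (Fin n → Fin d → ℂ) := Set.pi univ fun _ => K with hX
  have hXc : IsCompact X := isCompact_univ_pi fun _ => hK
  have : CompactSpace X := isCompact_iff_compactSpace.1 hXc
  set π := Measure.pi fun _ : Fin n => ν with hπ
  set m : Measure X := π.comap Subtype.val with hmdef
  have hint : ∀ F : (Fin n → Fin d → ℂ) → ℂ, ∫ z, F z ∂π = ∫ x : X, F x ∂m := by
    intro F
    rw [hmdef, integral_subtype_comap hXc.measurableSet,
      Measure.restrict_eq_self_of_ae_mem (ae_pi_mem hνK)]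
  have hGm : Integrable (fun x : X => G x) m := by
    have := (integrableOn_iff_comap_subtypeVal hXc.measurableSet).1 (hG.integrableOn (s := X))
    exact this
  let S : Subalgebra ℂ C(X, ℂ) :=
    { carrier := {φ | ∃ P : MvPolynomial (Fin n × Fin d) ℂ, IsSymm P ∧ ∀ x : X, φ x = polyEval x P}
      mul_mem' := by
        rintro φ ψ ⟨P, hP, hφ⟩ ⟨Q, hQ, hψ⟩
        refine ⟨P * Q, fun s z => ?_, fun x => ?_⟩
        · have := hP s z
          have := hQ s z
          simp_all [polyEval]
        · simp [hφ, hψ, polyEval]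
      add_mem' := by
        rintro φ ψ ⟨P, hP, hφ⟩ ⟨Q, hQ, hψ⟩
        refine ⟨P + Q, fun s z => ?_, fun x => ?_⟩
        · have := hP s z
          have := hQ s z
          simp_all [polyEval]
        · simp [hφ, hψ, polyEval]
      algebraMap_mem' := fun c =>
        ⟨MvPolynomial.C c, fun s z => by simp [polyEval], fun x => by simp [polyEval]⟩ }
  let Φ' : C(X, ℂ) := ⟨fun x => Φ x, hΦ.comp continuous_subtype_val⟩
  have hmem : Φ' ∈ S.starClosure.topologicalClosure := by
    refine mem_topologicalClosure_of_forall_eq _ _ fun x y hxy => ?_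
    obtain ⟨s, hs⟩ := exists_perm_of_isSymm (x := x.1) (y := y.1) fun P hP => by
      refine hxy ⟨fun x => polyEval x.1 P, (continuous_polyEval P).comp continuous_subtype_val⟩ ?_
      exact Algebra.mem_sup_left ⟨P, hP, fun _ => rfl⟩
    change Φ x.1 = Φ y.1
    rw [hs, hΦs]
  have hcl : IsClosed {φ : C(X, ℂ) | ∫ x, φ x * G x ∂m = 0} := by
    refine isClosed_eq ?_ continuous_const
    refine (LipschitzWith.of_dist_le_mul (K := (∫ x : X, ‖G x‖ ∂m).toNNReal)
      fun φ ψ => ?_).continuous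
    have hi : ∀ φ : C(X, ℂ), Integrable (fun x : X => φ x * G x) m := fun φ =>
      hGm.bdd_mul φ.continuous.aestronglyMeasurable (c := ‖φ‖)
        (Eventually.of_forall fun x => φ.norm_coe_le_norm x)
    rw [dist_eq_norm, ← integral_sub (hi φ) (hi ψ), Real.coe_toNNReal _ (by positivity),
      mul_comm, ← integral_const_mul]
    refine norm_integral_le_of_norm_le (hGm.norm.const_mul _) (Eventually.of_forall fun x => ?_)
    rw [← sub_mul, norm_mul, ← dist_eq_norm]
    exact mul_le_mul_of_nonneg_right (ContinuousMap.dist_apply_le_dist x) (norm_nonneg _)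
  have hsub : (S.starClosure : Set C(X, ℂ)) ⊆ {φ : C(X, ℂ) | ∫ x, φ x * G x ∂m = 0} := by
    intro φ hφ
    -- By commutativity the star algebra generated by `S` is spanned by the products `p * star q`
    -- with `p`, `q` in `S`, which are exactly the functions covered by `hPQ`.
    have hφ' : φ ∈ Subalgebra.toSubmodule S * Subalgebra.toSubmodule (star S) := by
      rw [Subalgebra.mul_toSubmodule]
      exact hφ
    have hi : ∀ φ : C(X, ℂ), Integrable (fun x : X => φ x * G x) m := fun φ =>
      hGm.bdd_mul φ.continuous.aestronglyMeasurable (c := ‖φ‖)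
        (Eventually.of_forall fun x => φ.norm_coe_le_norm x)
    refine Submodule.mul_induction_on hφ' ?_ ?_
    · rintro p ⟨P, hP, hp⟩ q ⟨Q, hQ, hq⟩
      have := hPQ P Q hP hQ
      rw [hint] at this
      rw [mem_ofPred_eq, ← this]
      refine integral_congr_ae (Eventually.of_forall fun x => ?_)
      beta_reduce
      rw [← hq x, ← hp x]
      simp
    · intro p q hp hq
      rw [mem_ofPred_eq] at *
      rw [← add_zero (0 : ℂ)]
      nth_rewrite 1 [← hp]
      rw [← hq, ← integral_add (hi p) (hi q)]
      simp only [ContinuousMap.add_apply, add_mul]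
  rw [hint]
  exact closure_minimal hsub hcl hmem

theorem integral_comp_perm (s : Equiv.Perm (Fin n)) (F : (Fin n → Fin d → ℂ) → ℂ) :
    ∫ z, F (z ∘ s) ∂(Measure.pi fun _ : Fin n => ν) =
      ∫ z, F z ∂(Measure.pi fun _ : Fin n => ν) := by
  -- Transport along `s.symm` sends `z` to `z ∘ s`.
  have := (measurePreserving_piCongrLeft (fun _ : Fin n => ν) s.symm).integral_comp' F
  rw [← this]
  congr 1
  funext z
  congr 1
  funext i
  have := MeasurableEquiv.piCongrLeft_apply_apply s.symm (β := fun _ => Fin d → ℂ) z (s i)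
  simp only [Equiv.symm_apply_apply] at this
  exact this.symm

/-- An antisymmetric polynomial vanishes almost everywhere if the minors of the moment matrix
vanish. -/
theorem ae_polyEval_eq_zero (hK : IsCompact K) (hνK : ∀ᵐ z ∂ν, z ∈ K)
    (hm : Measurable h) (h1 : ∀ᵐ z ∂ν, ‖h z‖ = 1)
    (hdet : ∀ α β : Fin n → Fin d → ℕ, Matrix.det (Matrix.of fun i j =>
      ∫ w, ((∏ k, w k ^ α i k) * ∏ k, conj (w k) ^ β j k) * h w ∂ν) = 0)
    {W : MvPolynomial (Fin n × Fin d) ℂ} (hW : IsAntisymm W) :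
    ∀ᵐ z ∂(Measure.pi fun _ : Fin n => ν), polyEval z W = 0 := by
  set π := Measure.pi fun _ : Fin n => ν with hπ
  set G : (Fin n → Fin d → ℂ) → ℂ := fun z =>
    (polyEval z W * conj (polyEval z W)) * ∏ i, h (z i) with hGdef
  have hGi : Integrable G π := integrable_mul_prod_density hK hνK hm h1
    ((continuous_polyEval W).mul (Complex.continuous_conj.comp (continuous_polyEval W)))
  have hGs : ∀ (s : Equiv.Perm (Fin n)) z, G (z ∘ s) = G z := by
    intro s z
    have e : ∏ i, h ((z ∘ s) i) = ∏ i, h (z i) := Equiv.prod_comp s fun i => h (z i)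
    simp only [hGdef]
    rw [e, hW s z, map_mul, map_intCast, mul_mul_mul_comm, ← Int.cast_mul,
      ← Units.val_mul, Int.units_mul_self]
    simp
  have hsymm : ∀ Φ : (Fin n → Fin d → ℂ) → ℂ, Continuous Φ →
      (∀ (s : Equiv.Perm (Fin n)) z, Φ (z ∘ s) = Φ z) → ∫ z, Φ z * G z ∂π = 0 := by
    intro Φ hΦ hΦs
    refine integral_mul_eq_zero_of_symmetric hK hνK hGi (fun P Q hP hQ => ?_) hΦ hΦs
    -- `P conj(Q) |W|² = (PW) conj(QW)`, and `QW` is antisymmetric.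
    rw [← integral_polyEval_mul_conj_isAntisymm hK hνK hm h1 hdet (P * W) (hQ.mul_isAntisymm hW)]
    congr 1
    funext z
    simp only [hGdef, polyEval, map_mul]
    ring
  have hG0 : ∀ᵐ z ∂π, G z = 0 := by
    refine ae_eq_zero_of_integral_contDiff_smul_eq_zero hGi.locallyIntegrable fun g hg hgs => ?_
    have hgc : ∀ s : Equiv.Perm (Fin n),
        Continuous fun z : Fin n → Fin d → ℂ => (g (z ∘ s) : ℂ) := fun s =>
      Complex.continuous_ofReal.comp (hg.continuous.comp (by fun_prop))
    -- An arbitrary test function is symmetrized. As `G` and the product measure are invariant, all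
    -- `n!` summands have the same integral against `G`, so each of them is zero.
    have h0 := hsymm (fun z => ∑ s : Equiv.Perm (Fin n), (g (z ∘ s) : ℂ))
      (continuous_finsetSum _ fun s _ => hgc s) (fun t z => by
        refine Fintype.sum_equiv (Equiv.mulLeft t) _ _ fun s => ?_
        rfl)
    obtain ⟨C, hC⟩ := hgs.exists_bound_of_continuous hg.continuous
    have hi : ∀ s : Equiv.Perm (Fin n), Integrable (fun z => (g (z ∘ s) : ℂ) * G z) π := fun s =>
      hGi.bdd_mul (hgc s).aestronglyMeasurable (c := C)
        (Eventually.of_forall fun z => by simpa using hC (z ∘ s))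
    have hs : ∀ s : Equiv.Perm (Fin n),
        ∫ z, (g (z ∘ s) : ℂ) * G z ∂π = ∫ z, g z • G z ∂π := by
      intro s
      rw [hπ, ← integral_comp_perm s fun z => g z • G z]
      congr 1
      funext z
      rw [hGs, Complex.real_smul]
    simp_rw [Finset.sum_mul] at h0
    rw [integral_finsetSum _ fun s _ => hi s] at h0
    simp_rw [hs] at h0
    rw [Finset.sum_const, nsmul_eq_mul] at h0
    refine (mul_eq_zero.1 h0).resolve_left ?_
    simp [Finset.card_univ, Fintype.card_perm, n.factorial_ne_zero]
  filter_upwards [hG0, ae_pi_norm_prod_eq_one h1] with z hz hz1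
  have hne : ∏ i, h (z i) ≠ 0 := by
    intro e
    rw [e, norm_zero] at hz1
    exact zero_ne_one hz1
  rcases mul_eq_zero.1 ((mul_eq_zero.1 hz).resolve_right hne) with h | h
  · exact h
  · simpa using h

/-- **Luecking's theorem**: if the `n × n` minors of the moment matrix vanish, then the support of
the measure has fewer than `n` points. -/
theorem not_injective_of_forall_det_eq_zero (hK : IsCompact K) (hνK : ∀ᵐ z ∂ν, z ∈ K)
    (hm : Measurable h) (h1 : ∀ᵐ z ∂ν, ‖h z‖ = 1)
    (hdet : ∀ α β : Fin n → Fin d → ℕ, Matrix.det (Matrix.of fun i j =>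
      ∫ w, ((∏ k, w k ^ α i k) * ∏ k, conj (w k) ^ β j k) * h w ∂ν) = 0)
    {a : Fin n → Fin d → ℂ} (ha : ∀ i, a i ∈ ν.support) : ¬ Function.Injective a := by
  classical
  intro hinj
  -- Each `g j` is nonzero at `a j` and zero at the other points, so the matrix `g_j(a_i)` is
  -- diagonal with nonzero entries.
  choose g hga hg using fun j => exists_eval_ne_zero (Finset.univ.image a) (a j)
  have hW0 : polyEval a (detPoly g) ≠ 0 := by
    have : (Matrix.of fun i j => MvPolynomial.eval (a i) (g j)) =
        Matrix.diagonal fun i => MvPolynomial.eval (a i) (g i) := by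
      ext i j
      by_cases hij : i = j
      · simp [hij]
      · rw [Matrix.diagonal_apply_ne _ hij]
        exact hg j (a i) (by simp) (hinj.ne hij)
    rw [polyEval_detPoly, this, Matrix.det_diagonal]
    exact Finset.prod_ne_zero_iff.2 fun i _ => hga i
  have hae := ae_polyEval_eq_zero hK hνK hm h1 hdet (isAntisymm_detPoly g)
  have hU : IsOpen {z : Fin n → Fin d → ℂ | polyEval z (detPoly g) ≠ 0} :=
    isOpen_ne.preimage (continuous_polyEval _)
  -- A box around `a` on which the determinant does not vanish is null, yet its measure is the
  -- product of the measures of neighbourhoods of support points.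
  obtain ⟨u, hu, huU⟩ := isOpen_pi_iff'.1 hU a hW0
  have hz : Measure.pi (fun _ : Fin n => ν) (Set.pi univ u) = 0 :=
    measure_mono_null huU hae
  rw [Measure.pi_pi, Finset.prod_eq_zero_iff] at hz
  obtain ⟨i, -, hi⟩ := hz
  exact (((Measure.mem_support_iff_forall _).1 (ha i)) (u i) ((hu i).1.mem_nhds (hu i).2)).ne' hi

end Luecking


/-! ### The cycle of rank inequalities. -/

section Rank

variable {d : ℕ} {Ω : Opens (Fin d → ℂ)}

/-- The monomials belong to the Bergman space of a bounded open set. -/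
theorem exists_holo_eq_monomial (hbdd : Bornology.IsBounded (Ω : Set (Fin d → ℂ)))
    (α : Fin d → ℕ) : ∃ m : bergmanSpace Ω, ∀ z ∈ Ω, holo m z = ∏ j, z j ^ α j := by
  have hc : Continuous fun z : Fin d → ℂ => ∏ j, z j ^ α j := by fun_prop
  obtain ⟨C, hC⟩ := hbdd.isCompact_closure.exists_bound_of_continuousOn hc.continuousOn
  have : IsFiniteMeasure (volume.restrict (Ω : Set (Fin d → ℂ))) :=
    ⟨by rw [Measure.restrict_apply_univ]; exact hbdd.measure_lt_top⟩
  have hL : MemLp (fun z : Fin d → ℂ => ∏ j, z j ^ α j) 2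
      (volume.restrict (Ω : Set (Fin d → ℂ))) := by
    refine MemLp.of_bound hc.aestronglyMeasurable C ?_
    filter_upwards [ae_restrict_mem Ω.isOpen.measurableSet] with z hz
    exact hC z (subset_closure hz)
  have hd : DifferentiableOn ℂ (fun z : Fin d → ℂ => ∏ j, z j ^ α j) Ω :=
    ((contDiff_prod (n := 1) fun j _ => by fun_prop).differentiable one_ne_zero).differentiableOn
  refine ⟨⟨hL.toLp _, _, hd, hL.coeFn_toLp⟩, fun z hz => ?_⟩
  exact holo_eqOn_of_ae_eq _ hd hL.coeFn_toLp hz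

theorem inner_toeplitz_eq_momentMatrix {μ : ComplexMeasure (Fin d → ℂ)}
    (hμ : HasCompactSupportIn μ Ω) {m : (Fin d → ℕ) → bergmanSpace Ω}
    (hm : ∀ α, ∀ z ∈ Ω, holo (m α) z = ∏ j, z j ^ α j) (α β : Fin d → ℕ) :
    inner ℂ (m β) (toeplitz Ω μ hμ (m α)) = momentMatrix μ α β := by
  rw [inner_toeplitz]
  obtain ⟨K, hK, hKΩ, hμK⟩ := hμ
  refine VectorMeasure.integral_congr_ae ?_
  filter_upwards [ae_mem_of_support hK hμK] with z hz
  rw [hm α z (hKΩ hz), hm β z (hKΩ hz), map_prod]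
  simp_rw [map_pow]

/-- Column `β` of the moment matrix lists the values of the functional `⟨z^β, ·⟩` at the vectors `T
z^α`. The column space is therefore contained in a linear image of the dual of the range of `T`. -/
theorem eRank_momentMatrix_le (hbdd : Bornology.IsBounded (Ω : Set (Fin d → ℂ)))
    {μ : ComplexMeasure (Fin d → ℂ)} (hμ : HasCompactSupportIn μ Ω) :
    (momentMatrix μ).eRank ≤ eRank (toeplitz Ω μ hμ) := by
  choose m hm using exists_holo_eq_monomial hbdd
  set T := toeplitz Ω μ hμ with hT
  -- The finite case is split off because a space and its dual have equal dimension only in finite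
  -- dimension.
  rcases le_or_gt Cardinal.aleph0 T.rank with hinf | hfin
  · rw [eRank, Cardinal.toENat_eq_top.2 hinf]
    exact le_top
  have hfd : FiniteDimensional ℂ (LinearMap.range T) := Module.rank_lt_aleph0_iff.1 hfin
  refine OrderHomClass.mono Cardinal.toENat ?_
  let L : Module.Dual ℂ (LinearMap.range T) →ₗ[ℂ] ((Fin d → ℕ) → ℂ) :=
    LinearMap.pi fun α => LinearMap.applyₗ ⟨T (m α), LinearMap.mem_range_self T _⟩
  have hle : Submodule.span ℂ (range (momentMatrix μ).col) ≤ LinearMap.range L := by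
    rw [Submodule.span_le]
    rintro _ ⟨β, rfl⟩
    refine ⟨(innerₛₗ ℂ (m β)).comp (LinearMap.range T).subtype, ?_⟩
    funext α
    exact inner_toeplitz_eq_momentMatrix hμ hm α β
  calc (momentMatrix μ).cRank ≤ Module.rank ℂ (LinearMap.range L) := Submodule.rank_mono hle
    _ ≤ Module.rank ℂ (Module.Dual ℂ (LinearMap.range T)) := rank_range_le L
    _ = Module.rank ℂ (LinearMap.range T) := by
      rw [← Module.finrank_eq_rank, ← Module.finrank_eq_rank, Subspace.dual_finrank_eq]

/-- `‖T u‖² = ∫ u conj(T u) dμ`, whose integrand vanishes almost everywhere. -/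
theorem toeplitz_eq_zero {μ : ComplexMeasure (Fin d → ℂ)} (hμ : HasCompactSupportIn μ Ω)
    {u : bergmanSpace Ω} (hu : ∀ᵐ z ∂(VectorMeasure.variation μ), holo u z = 0) :
    toeplitz Ω μ hμ u = 0 := by
  rw [← inner_self_eq_zero (𝕜 := ℂ), inner_toeplitz]
  refine VectorMeasure.integral_eq_zero_of_ae ?_
  filter_upwards [hu] with z hz
  simp [hz]

/-- For finite `S`, a function vanishing on `S` is killed by `T`, so `T` factors through the
evaluation map into `ℂ^S`. -/
theorem eRank_toeplitz_le_encard {μ : ComplexMeasure (Fin d → ℂ)} (hμ : HasCompactSupportIn μ Ω)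
    {S : Set (Fin d → ℂ)} (hS : ∀ᵐ z ∂(VectorMeasure.variation μ), z ∈ S) :
    eRank (toeplitz Ω μ hμ) ≤ S.encard := by
  rcases S.finite_or_infinite with hfin | hinf
  swap
  · rw [hinf.encard_eq]
    exact le_top
  have := hfin.fintype
  let E : bergmanSpace Ω →ₗ[ℂ] (S → ℂ) := LinearMap.pi fun a => (evalCLM Ω a.1).toLinearMap
  set T := toeplitz Ω μ hμ with hT
  have hker : LinearMap.ker E ≤ LinearMap.ker T := by
    intro u hu
    refine toeplitz_eq_zero hμ ?_
    filter_upwards [hS] with z hz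
    exact congrFun (LinearMap.mem_ker.1 hu) ⟨z, hz⟩
  have h : T.rank ≤ (Fintype.card S : Cardinal) :=
    calc T.rank = Module.rank ℂ (LinearMap.range ((LinearMap.ker E).liftQ T hker)) := by
          rw [Submodule.range_liftQ]
      _ ≤ Module.rank ℂ (bergmanSpace Ω ⧸ LinearMap.ker E) := rank_range_le _
      _ = Module.rank ℂ (LinearMap.range E) := E.quotKerEquivRange.rank_eq
      _ ≤ Module.rank ℂ (S → ℂ) := Submodule.rank_le _
      _ = Fintype.card S := rank_fun'
  rw [encard_eq_coe_toFinset_card, toFinset_card, eRank]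
  exact Cardinal.toENat_le_natCast.2 h

theorem _root_.Matrix.det_submatrix_eq_zero_of_eRank_lt {m₁ m₂ : Type*} {n : ℕ}
    (A : Matrix m₁ m₂ ℂ) (hA : A.eRank < n) (r : Fin n → m₁) (c : Fin n → m₂) :
    (A.submatrix r c).det = 0 := by
  by_contra hdet
  have h1 : (A.submatrix r c).rank = n := by
    rw [Matrix.rank_of_isUnit _ ((Matrix.isUnit_iff_isUnit_det _).2 (isUnit_iff_ne_zero.2 hdet)),
      Fintype.card_fin]
  have h2 : (A.submatrix r c).eRank < n := (A.eRank_submatrix_le r c).trans_lt hA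
  rw [← Matrix.eRank_toNat_eq_rank] at h1
  rw [← ENat.natCast_toNat h2.ne_top, h1] at h2
  exact lt_irrefl _ h2

/-- A complex measure whose moment matrix has finite rank `N` is carried by at most `N` points. -/
theorem encard_support_le_eRank_momentMatrix {μ : ComplexMeasure (Fin d → ℂ)}
    (hμ : HasCompactSupportIn μ Ω) :
    (VectorMeasure.variation μ).support.encard ≤ (momentMatrix μ).eRank := by
  by_contra! hlt
  have := isFiniteMeasure_variation μ
  obtain ⟨K, hK, hKΩ, hμK⟩ := hμ
  have hνK := ae_mem_of_support hK hμK
  obtain ⟨h, hm, h1, hμh⟩ := exists_polar_density μ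
  obtain ⟨N, hN⟩ := ENat.ne_top_iff_exists.1 hlt.ne_top
  rw [← hN] at hlt
  -- With `N` the rank, a support of more than `N` points, possibly infinite, contains `N + 1`
  -- distinct ones, while all minors of size `N + 1` vanish.
  obtain ⟨t, ht, htN⟩ := exists_subset_encard_eq (Order.add_one_le_of_lt hlt)
  have htf : t.Finite := finite_of_encard_eq_coe (k := N + 1) (by exact_mod_cast htN)
  have := htf.fintype
  have hcard : Fintype.card t = N + 1 := by
    rw [encard_eq_coe_toFinset_card, toFinset_card] at htN
    exact_mod_cast htN
  let e := Fintype.equivFinOfCardEq hcard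
  refine not_injective_of_forall_det_eq_zero (n := N + 1) (a := fun i => (e.symm i : Fin d → ℂ))
    hK hνK hm h1 (fun α β => ?_) (fun i => ht (e.symm i).2)
    (Subtype.val_injective.comp e.symm.injective)
  have hmin := (momentMatrix μ).det_submatrix_eq_zero_of_eRank_lt (n := N + 1)
    (by rw [← hN]; exact_mod_cast N.lt_succ_self) α β
  rw [← hmin]
  congr 1
  ext i j
  refine (cintegral_eq_integral_mul hm h1 hμh ?_).symm
  have hcw : Continuous fun w : Fin d → ℂ => (∏ k, w k ^ α i k) * ∏ k, conj (w k) ^ β j k := by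
    have := Complex.continuous_conj
    fun_prop
  obtain ⟨C, hC⟩ := hK.exists_bound_of_continuousOn hcw.continuousOn
  exact Integrable.of_bound hcw.aestronglyMeasurable C (hνK.mono fun w hw => hC w hw)

end Rank

end BergmanToeplitz

theorem proposition3 (d : ℕ) (Ω : TopologicalSpace.Opens (Fin d → ℂ))
    (hconn : IsConnected (Ω : Set (Fin d → ℂ)))
    (hbdd : Bornology.IsBounded (Ω : Set (Fin d → ℂ)))
    (μ : MeasureTheory.ComplexMeasure (Fin d → ℂ))
    (hμ : BergmanToeplitz.HasCompactSupportIn μ Ω) :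
    (BergmanToeplitz.momentMatrix μ).eRank =
      BergmanToeplitz.eRank (BergmanToeplitz.toeplitz Ω μ hμ) :=
  le_antisymm (BergmanToeplitz.eRank_momentMatrix_le hbdd hμ)
    ((BergmanToeplitz.eRank_toeplitz_le_encard hμ MeasureTheory.Measure.support_mem_ae).trans
      (BergmanToeplitz.encard_support_le_eRank_momentMatrix hμ))
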